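/- Let $X$ and $S$ be real analytic manifolds (finite-dimensional, Hausdorff, with countable basis). **Sites.** (1) $X_{sa}$: the objects are the subanalytic open subsets of $X$; a family $\{U_i\}$ of subanalytic open subsets of $U$ covers $U$ if for every compact $K\subset X$ there is a finite subfamily whose union $U_0$ satisfies $K\cap U_0=K\cap U$. (2) $X_{sa}\times S_{sa}$: the objects are the open subsets of $X\times S$ that are locally finite unions of products $U\times V$ with $U\subset X$, $V\subset S$ relatively compact subanalytic open; a family $T$ of objects contained in $W$ covers $W$ if for every such product $U\times V\subset W$ finitely many members of $T$ cover $U\times V$. (3) $X_{sa}\times S$: the objects are the finite unions of products $U\times V$ with $U\subset X$ subanalytic open and $V\subset S$ open. The topology is the Grothendieck topology generated by the following families: $T$ covers $W$ if for every product $U\times V\subset W$ of this kind there are a covering $\{U_i\}$ of $U$ in $X_{sa}$ and an open covering $\{V_j\}$ of $V$ such that each $U_i\times V_j$ is contained in a member of $T$. Sheaves are sheaves of complex vector spaces. **Inverse image.** For a sheaf $F$ on $X_{sa}\times S_{sa}$, let $a^{-1}F$ be its inverse image under the natural morphism of sites $a: X_{sa}\times S\to X_{sa}\times S_{sa}$,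 that is, the sheaf on $X_{sa}\times S$ associated with the presheaf $W\mapsto \varinjlim_{W'\supset W}\Gamma(W';F)$, where $W'$ runs through the objects of $X_{sa}\times S_{sa}$ containing $W$. **$\mathcal T$-flabby.** Let $\mathcal T$ be the family of finite unions of products $U\times V$ with $U\subset X$, $V\subset S$ relatively compact subanalytic open. The sheaf $F$ is $\mathcal T$-flabby if $\Gamma(X\times S;F)\to\Gamma(W;F)$ is surjective for every $W\in\mathcal T$. **c-soft.** For objects $V\subset U$ of $X_{sa}\times S$, say that $V$ is weakly quasi-compact in $U$, written $V\overset{wc}{\to}U$, if for every covering of $U$ the induced covering of $V$ has a finite refinement which is a covering of $V$. A sheaf $G$ on $X_{sa}\times S$ is c-soft if, for all objects $V,W,Y$ with $V\overset{wc}{\to}Y$, $W\overset{wc}{\to}Y$ and $V\overset{wc}{\to}W$, the natural map $\Gamma(W;G)\to\varinjlim_{V\overset{wc}{\to}U}\Gamma(U;G)$ is surjective. **Proposition.** If $F$ is a $\mathcal T$-flabby sheaf on $X_{sa}\times S_{sa}$, then $a^{-1}F$ is c-soft on $X_{sa}\times S$. -/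

import Mathlib

open CategoryTheory CategoryTheory.Limits TopologicalSpace Opposite
open scoped Manifold ContDiff Topology

universe u

/-! ### Subanalytic subsets of a real analytic manifold -/

/-- `A` is semianalytic: near every point of the manifold it belongs to the Boolean algebra
generated by the sets `{f > 0}` with `f` real analytic, i.e. it is described by a condition on
the signs of finitely many real analytic functions. -/
def IsSemianalytic {E H M : Type*} [NormedAddCommGroup E] [NormedSpace ℝ E] [TopologicalSpace H]
    [TopologicalSpace M] [ChartedSpace H M] (I : ModelWithCorners ℝ E H) (A : Set M) : Prop :=
  ∀ x : M, ∃ N : Set M, IsOpen N ∧ x ∈ N ∧ ∃ (k : ℕ) (f : Fin k → M → ℝ),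
    (∀ i, ContMDiffOn I 𝓘(ℝ, ℝ) ω (f i) N) ∧ ∃ C : Set (Fin k → SignType),
      ∀ y ∈ N, y ∈ A ↔ (fun i => SignType.sign (f i y)) ∈ C

/-- `A ⊆ M` is subanalytic: every point of `M` has an open neighbourhood `N` such that `A ∩ N` is
the projection to `M` of a relatively compact semianalytic subset of some `M × ℝᵐ`. -/
def IsSubanalytic (n : ℕ) {M : Type*} [TopologicalSpace M]
    [ChartedSpace (EuclideanSpace ℝ (Fin n)) M] (A : Set M) : Prop :=
  ∀ x : M, ∃ N : Set M, IsOpen N ∧ x ∈ N ∧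
    ∃ (m : ℕ) (B : Set (M × EuclideanSpace ℝ (Fin m))),
      IsSemianalytic ((𝓡 n).prod (𝓡 m)) B ∧ IsCompact (closure B) ∧ A ∩ N = Prod.fst '' B

/-- `𝒰` is a covering of the subanalytic open set `U` in the subanalytic site. -/
def IsSaCovering (n : ℕ) {M : Type*} [TopologicalSpace M]
    [ChartedSpace (EuclideanSpace ℝ (Fin n)) M] (𝒰 : Set (Opens M)) (U : Opens M) : Prop :=
  (∀ U' ∈ 𝒰, IsSubanalytic n (U' : Set M) ∧ U' ≤ U) ∧
    ∀ K : Set M, IsCompact K → ∃ 𝒰₀ ⊆ 𝒰, 𝒰₀.Finite ∧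
      K ∩ (sSup 𝒰₀ : Opens M) = K ∩ (U : Set M)

/-- Coordinate balls: every neighbourhood of a point contains a relatively compact subanalytic
open neighbourhood. -/
theorem exists_subanalytic_nhd (n : ℕ) {M : Type*} [TopologicalSpace M] [T2Space M]
    [ChartedSpace (EuclideanSpace ℝ (Fin n)) M] [IsManifold (𝓡 n) ω M] (x : M) {O : Set M}
    (hO : O ∈ 𝓝 x) : ∃ U : Opens M, x ∈ U ∧ (U : Set M) ⊆ O ∧ IsSubanalytic n (U : Set M) ∧
      IsCompact (closure (U : Set M)) := by
  set e := chartAt (EuclideanSpace ℝ (Fin n)) x with he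
  have hx : x ∈ e.source := mem_chart_source _ x
  have h1 : e.target ∩ e.symm ⁻¹' O ∈ 𝓝 (e x) := by
    refine Filter.inter_mem (e.open_target.mem_nhds (e.map_source hx)) ?_
    refine (e.continuousAt_symm (e.map_source hx)).preimage_mem_nhds ?_
    rwa [e.left_inv hx]
  obtain ⟨r, hr, hball⟩ := Metric.nhds_basis_closedBall.mem_iff.1 h1
  have hUo : IsOpen (e.source ∩ e ⁻¹' Metric.ball (e x) r) :=
    e.isOpen_inter_preimage Metric.isOpen_ball
  set K : Set M := e.symm '' Metric.closedBall (e x) r with hK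
  have hKc : IsCompact K :=
    (isCompact_closedBall _ _).image_of_continuousOn
      (e.continuousOn_symm.mono fun y hy => (hball hy).1)
  have hUK : e.source ∩ e ⁻¹' Metric.ball (e x) r ⊆ K := fun y hy =>
    ⟨e y, Metric.ball_subset_closedBall hy.2, e.left_inv hy.1⟩
  have hKs : K ⊆ e.source := by
    rintro _ ⟨z, hz, rfl⟩
    exact e.map_target (hball hz).1
  refine ⟨⟨_, hUo⟩, ⟨hx, Metric.mem_ball_self hr⟩, ?_, ?_,
    hKc.of_isClosed_subset isClosed_closure (closure_minimal hUK hKc.isClosed)⟩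
  · intro y hy
    have := (hball (Metric.ball_subset_closedBall hy.2)).2
    rwa [Set.mem_preimage, e.left_inv hy.1] at this
  · intro y
    refine ⟨Set.univ, isOpen_univ, trivial, 0,
      Prod.fst ⁻¹' (e.source ∩ e ⁻¹' Metric.ball (e x) r), ?_, ?_, ?_⟩
    · rintro ⟨y, z⟩
      by_cases hy : y ∈ e.source
      · refine ⟨Prod.fst ⁻¹' e.source, e.open_source.preimage continuous_fst, hy, 1,
          fun _ p => r ^ 2 - ‖e p.1 - e x‖ ^ 2, fun _ => ?_, {s | s 0 = 1}, ?_⟩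
        · have h2 : ContMDiffOn ((𝓡 n).prod (𝓡 0)) (𝓡 n) ω
              (fun p : M × EuclideanSpace ℝ (Fin 0) => e p.1) (Prod.fst ⁻¹' e.source) :=
            (contMDiffOn_chart (I := 𝓡 n) (n := ω) (x := x)).comp
              contMDiff_fst.contMDiffOn (fun p hp => hp)
          have h3 : ContDiff ℝ ω (fun v : EuclideanSpace ℝ (Fin n) => r ^ 2 - ‖v - e x‖ ^ 2) :=
            contDiff_const.sub ((contDiff_id.sub contDiff_const).norm_sq ℝ)
          exact h3.contMDiff.comp_contMDiffOn h2
        · rintro ⟨p, q⟩ hp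
          have hp' : p ∈ e.source := hp
          simp only [Set.mem_preimage, Set.mem_inter_iff, hp', true_and, Metric.mem_ball,
            dist_eq_norm, Set.mem_ofPred_eq, sign_eq_one_iff, sub_pos]
          exact (sq_lt_sq₀ (norm_nonneg _) hr.le).symm
      · refine ⟨Prod.fst ⁻¹' Kᶜ, hKc.isClosed.isOpen_compl.preimage continuous_fst,
          fun h => hy (hKs h), 0, fun i => i.elim0, fun i => i.elim0, ∅, ?_⟩
        rintro ⟨p, q⟩ hp
        simp only [Set.mem_empty_iff_false, iff_false]
        exact fun h => hp (hUK h)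
    · refine (hKc.prod isCompact_univ).of_isClosed_subset isClosed_closure
        (closure_minimal (t := K ×ˢ (Set.univ : Set (EuclideanSpace ℝ (Fin 0))))
          (fun p hp => ⟨hUK hp, trivial⟩) (hKc.isClosed.prod isClosed_univ))
    · rw [Set.inter_univ, Set.image_preimage_eq _ Prod.fst_surjective]
      rfl

/-- The product `U × V` as an open subset of `X × S`. -/
def openBox {X S : Type*} [TopologicalSpace X] [TopologicalSpace S] (U : Opens X) (V : Opens S) :
    Opens (X × S) :=
  ⟨(U : Set X) ×ˢ (V : Set S), U.isOpen.prod V.isOpen⟩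

/-! ### Sites given by a partially ordered family of objects -/

/-- The Grothendieck topology on a preorder generated by a class of covering families: `cov W` is
the set of families `T` such that the members `≤ W` of `T` cover `W`. -/
def generatedTopology {C : Type*} [Preorder C] (cov : C → Set (Set C)) : GrothendieckTopology C :=
  Precoverage.toGrothendieck
    { coverings := fun W => {R | {W' | ∃ f : W' ⟶ W, R f} ∈ cov W} }

/-- `V` is weakly quasi-compact in `U`: for every covering of `U`, the induced covering of `V`
admits a finite refinement which is a covering of `V`. -/
def IsWeaklyQuasiCompactIn {C : Type*} [Preorder C] (J : GrothendieckTopology C) (V U : C) :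
    Prop :=
  ∃ h : V ≤ U, ∀ R ∈ J U, ∃ T : Set C, T.Finite ∧
    (∀ W ∈ T, ∃ hW : W ≤ V, R (homOfLE (hW.trans h))) ∧
    Sieve.generate (X := V) (fun W _ => W ∈ T) ∈ J V

/-- The poset of the objects `U` in which `V` is weakly quasi-compact. -/
abbrev WeaklyQuasiCompactNhd {C : Type u} [Preorder C] (J : GrothendieckTopology C) (V : C) :
    Type u :=
  {U : C // IsWeaklyQuasiCompactIn J V U}

/-- The inductive system `U ↦ Γ(U; F)`, where `U` runs through the objects in which `V` is weakly
quasi-compact, ordered by reverse inclusion. -/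
def germSystem {C : Type u} [Preorder C] {J : GrothendieckTopology C}
    (F : Sheaf J (ModuleCat.{u} ℂ)) (V : C) :
    (WeaklyQuasiCompactNhd J V)ᵒᵖ ⥤ ModuleCat.{u} ℂ :=
  (Subtype.mono_coe (IsWeaklyQuasiCompactIn J V)).functor.op ⋙ F.obj

/-- `F` is c-soft: `Γ(W; F) → colim_U Γ(U; F)`, the colimit over the `U` in which `V` is weakly
quasi-compact, is surjective whenever `V`, `W` are weakly quasi-compact in some `Y` and `V` is
weakly quasi-compact in `W`. -/
def IsCSoft {C : Type u} [Preorder C] {J : GrothendieckTopology C}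
    (F : Sheaf J (ModuleCat.{u} ℂ)) : Prop :=
  ∀ (Y V W : C), IsWeaklyQuasiCompactIn J V Y → IsWeaklyQuasiCompactIn J W Y →
    ∀ hVW : IsWeaklyQuasiCompactIn J V W,
      Function.Surjective (colimit.ι (germSystem F V) (op ⟨W, hVW⟩)).hom

/-- Needed for the sheafification of presheaves of complex vector spaces in any universe. -/
instance preservesFilteredColimits_forget_moduleCat_complex :
    PreservesFilteredColimits (forget (ModuleCat.{u} ℂ)) :=
  Limits.comp_preservesFilteredColimits.{u, u} (forget₂ (ModuleCat.{u} ℂ) AddCommGrpCat.{u})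
    (forget AddCommGrpCat.{u})

section ProductSites

variable (n d : ℕ) (X S : Type u) [TopologicalSpace X] [TopologicalSpace S]
  [ChartedSpace (EuclideanSpace ℝ (Fin n)) X] [ChartedSpace (EuclideanSpace ℝ (Fin d)) S]

variable {X S} in
/-- `P = U × V` with `U`, `V` relatively compact subanalytic open subsets of `X` and `S`. -/
def IsSaBox (P : Opens (X × S)) : Prop :=
  ∃ (U : Opens X) (V : Opens S), IsSubanalytic n (U : Set X) ∧ IsCompact (closure (U : Set X)) ∧
    IsSubanalytic d (V : Set S) ∧ IsCompact (closure (V : Set S)) ∧ P = openBox U V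

variable {X S} in
/-- The family `𝒯`: finite unions of products `U × V` with `U`, `V` relatively compact
subanalytic open subsets of `X` and `S`. -/
def IsFiniteUnionOfSaBoxes (W : Opens (X × S)) : Prop :=
  ∃ 𝓑 : Set (Opens (X × S)), 𝓑.Finite ∧ (∀ P ∈ 𝓑, IsSaBox n d P) ∧ W = sSup 𝓑

/-- `op(X_sa × S_sa)`: locally finite unions of products of relatively compact subanalytic open
subsets. -/
abbrev OpSaSa : Type u :=
  {W : Opens (X × S) // ∃ 𝓑 : Set (Opens (X × S)), (∀ P ∈ 𝓑, IsSaBox n d P) ∧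
    LocallyFinite (fun P : 𝓑 => ((P : Opens (X × S)) : Set (X × S))) ∧ W = sSup 𝓑}

/-- The coverings of the site `X_sa × S_sa`: a family covers `W` if its trace on each product
`U × V ⊆ W` of relatively compact subanalytic open sets admits a finite subcover. -/
def saSaCoverings (W : OpSaSa n d X S) : Set (Set (OpSaSa n d X S)) :=
  {T | ∀ P : Opens (X × S), IsSaBox n d P → P ≤ W.1 →
    ∃ T₀ ⊆ T, T₀.Finite ∧ (P : Set (X × S)) ⊆ ⋃ W' ∈ T₀, ((W' : Opens (X × S)) : Set (X × S))}

/-- The site `X_sa × S_sa`. -/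
abbrev saSaTopology : GrothendieckTopology (OpSaSa n d X S) :=
  generatedTopology (saSaCoverings n d X S)

/-- `X × S` is a locally finite union of products of relatively compact subanalytic open sets. -/
theorem exists_locallyFinite_saBoxes [T2Space X] [SecondCountableTopology X]
    [IsManifold (𝓡 n) ω X] [T2Space S] [SecondCountableTopology S] [IsManifold (𝓡 d) ω S] :
    ∃ 𝓑 : Set (Opens (X × S)), (∀ P ∈ 𝓑, IsSaBox n d P) ∧
      LocallyFinite (fun P : 𝓑 => ((P : Opens (X × S)) : Set (X × S))) ∧ ⊤ = sSup 𝓑 := by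
  have : LocallyCompactSpace X := ChartedSpace.locallyCompactSpace (EuclideanSpace ℝ (Fin n)) X
  have : LocallyCompactSpace S := ChartedSpace.locallyCompactSpace (EuclideanSpace ℝ (Fin d)) S
  have hB : ∀ p : X × S, (𝓝 p).HasBasis (fun P : Opens (X × S) => p ∈ P ∧ IsSaBox n d P)
      (fun P => (P : Set (X × S))) := by
    refine fun p => ⟨fun O => ⟨fun hO => ?_, ?_⟩⟩
    · obtain ⟨O₁, h₁, O₂, h₂, h⟩ := mem_nhds_prod_iff.1 hO
      obtain ⟨U, hxU, hUO, hU, hUc⟩ := exists_subanalytic_nhd n p.1 h₁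
      obtain ⟨V, hxV, hVO, hV, hVc⟩ := exists_subanalytic_nhd d p.2 h₂
      exact ⟨openBox U V, ⟨⟨hxU, hxV⟩, U, V, hU, hUc, hV, hVc, rfl⟩,
        (Set.prod_mono hUO hVO).trans h⟩
    · rintro ⟨P, ⟨hp, -⟩, hPO⟩
      exact Filter.mem_of_superset (P.isOpen.mem_nhds hp) hPO
  obtain ⟨α, c, P, hP, hcov, hfin⟩ :=
    refinement_of_locallyCompact_sigmaCompact_of_nhds_basis.{u, u} hB
  refine ⟨Set.range P, ?_, ?_, ?_⟩
  · rintro _ ⟨a, rfl⟩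
    exact (hP a).2
  · refine hfin.on_range.comp_injective
      (g := fun Q : Set.range P => (⟨Q.1, Q.2.imp fun a h => congrArg _ h⟩ :
        Set.range fun a => (P a : Set (X × S)))) fun Q Q' h => ?_
    exact Subtype.ext (Opens.ext (Subtype.ext_iff.1 h))
  · refine (eq_top_iff.2 fun p _ => ?_).symm
    obtain ⟨a, ha⟩ := Set.mem_iUnion.1 (hcov.symm ▸ Set.mem_univ p : p ∈ ⋃ a, (P a : Set _))
    exact Opens.mem_sSup.2 ⟨P a, ⟨a, rfl⟩, ha⟩

/-- `X × S` as an object of `op(X_sa × S_sa)`. -/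
def saSaTop [T2Space X] [SecondCountableTopology X] [IsManifold (𝓡 n) ω X] [T2Space S]
    [SecondCountableTopology S] [IsManifold (𝓡 d) ω S] : OpSaSa n d X S :=
  ⟨⊤, exists_locallyFinite_saBoxes n d X S⟩

variable {n d X S} in
/-- `F` is `𝒯`-flabby: `Γ(X × S; F) → Γ(W; F)` is surjective for every `W ∈ 𝒯`. -/
def IsTFlabby [T2Space X] [SecondCountableTopology X] [IsManifold (𝓡 n) ω X] [T2Space S]
    [SecondCountableTopology S] [IsManifold (𝓡 d) ω S]
    (F : Sheaf (saSaTopology n d X S) (ModuleCat.{u} ℂ)) : Prop :=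
  ∀ W : OpSaSa n d X S, IsFiniteUnionOfSaBoxes n d W.1 →
    Function.Surjective
      (F.obj.map (homOfLE (le_top (a := W.1)) : W ⟶ saSaTop n d X S).op).hom

/-- `op(X_sa × S)`: finite unions of products `U × V` with `U ⊆ X` subanalytic open and `V ⊆ S`
open. -/
abbrev OpSa : Type u :=
  {W : Opens (X × S) // ∃ 𝓑 : Set (Opens (X × S)), 𝓑.Finite ∧
    (∀ P ∈ 𝓑, ∃ (U : Opens X) (V : Opens S), IsSubanalytic n (U : Set X) ∧ P = openBox U V) ∧
    W = sSup 𝓑}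

/-- The coverings generating the site `X_sa × S`: a family covers `W` if on each product
`U × V ⊆ W` (`U` subanalytic open, `V` open) it is refined by `{Uᵢ × Vⱼ}` for a covering `{Uᵢ}`
of `U` in `X_sa` and an open covering `{Vⱼ}` of `V`. -/
def saCoverings (W : OpSa n X S) : Set (Set (OpSa n X S)) :=
  {T | ∀ (U : Opens X) (V : Opens S), IsSubanalytic n (U : Set X) → openBox U V ≤ W.1 →
    ∃ (𝒰 : Set (Opens X)) (𝒱 : Set (Opens S)), IsSaCovering n 𝒰 U ∧ sSup 𝒱 = V ∧
      ∀ U' ∈ 𝒰, ∀ V' ∈ 𝒱, ∃ W' ∈ T, openBox U' V' ≤ W'.1}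

/-- The site `X_sa × S`. -/
abbrev saTopology : GrothendieckTopology (OpSa n X S) :=
  generatedTopology (saCoverings n X S)

/-- The inclusion of `op(X_sa × S_sa)` into the open subsets of `X × S`. -/
abbrev saSaInclusion : OpSaSa n d X S ⥤ Opens (X × S) :=
  Monotone.functor (f := fun W : OpSaSa n d X S => W.1) (Subtype.mono_coe _)

/-- The inclusion of `op(X_sa × S)` into the open subsets of `X × S`. -/
abbrev saInclusion : OpSa n X S ⥤ Opens (X × S) :=
  Monotone.functor (f := fun W : OpSa n X S => W.1) (Subtype.mono_coe _)

variable {n d X S} in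
/-- The presheaf `W ↦ colim_{W' ⊇ W} Γ(W'; F)` on `op(X_sa × S)`, the colimit being over the
`W' ∈ op(X_sa × S_sa)` containing `W`: the (pointwise) left Kan extension of `F` to all open
subsets of `X × S`, restricted to `op(X_sa × S)`. -/
noncomputable def inverseImagePresheaf (F : Sheaf (saSaTopology n d X S) (ModuleCat.{u} ℂ)) :
    (OpSa n X S)ᵒᵖ ⥤ ModuleCat.{u} ℂ :=
  (saInclusion n X S).op ⋙ (saSaInclusion n d X S).op.lan.obj F.obj

variable {n d X S} in
/-- The inverse image `a⁻¹F` on `X_sa × S` of a sheaf `F` on `X_sa × S_sa`, for the natural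
morphism of sites `a : X_sa × S → X_sa × S_sa`: the sheaf associated with the presheaf
`W ↦ colim_{W' ⊇ W} Γ(W'; F)`. -/
noncomputable def inverseImage (F : Sheaf (saSaTopology n d X S) (ModuleCat.{u} ℂ)) :
    Sheaf (saTopology n X S) (ModuleCat.{u} ℂ) :=
  (presheafToSheaf (saTopology n X S) (ModuleCat.{u} ℂ)).obj (inverseImagePresheaf F)

end ProductSites

/-! ### Intersections of subanalytic sets -/

section Subanalytic

variable {E H M E' H' M' : Type*} [NormedAddCommGroup E] [NormedSpace ℝ E] [TopologicalSpace H]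
    [TopologicalSpace M] [ChartedSpace H M] [NormedAddCommGroup E'] [NormedSpace ℝ E']
    [TopologicalSpace H'] [TopologicalSpace M'] [ChartedSpace H' M']
    {I : ModelWithCorners ℝ E H} {I' : ModelWithCorners ℝ E' H'}

/-! The proof rests on one relation, `WellInside`, and one explicit model of the inverse image.

An object `V` is well inside `O` if it is a finite union of boxes `A × B`, with relatively compact
factors, such that `A × D` lies in `O` for some open `D` containing the closure of `B`. Only the
`S`-factor is shrunk: coverings in `X_sa` are already finite on compact sets, whereas an open
covering of a subset of `S` becomes finite only on a compact part. This relation is exactly weak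
quasi-compactness (`isWeaklyQuasiCompactIn_iff`), and a member of `𝒯` can always be inserted between
`V` and `O` (`WellInside.exists_between`).

The model sends `O` to the compatible families of sections of `F` over the members of `𝒯` well
inside `O`. It is a sheaf on `X_sa × S` (`isSheaf_interiorPresheaf`), and the inverse image presheaf
maps to it by a locally bijective morphism, so it is `a⁻¹F` (`nonempty_inverseImage_iso`).

Softness is then immediate. Let `s` be a section over `U`, with `V` well inside `U` and `W`. Insert
`P ∈ 𝒯` between `V` and `U ∩ W`. The component of `s` at `P` is a section of `F` over `P`; by
`𝒯`-flabbiness it extends to `X × S`, and the restriction of this extension to `W` agrees with `s`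
on `P`. -/

theorem IsSemianalytic.preimage {A : Set M} (hA : IsSemianalytic I A) {φ : M' → M}
    (hφ : ContMDiff I' I ω φ) : IsSemianalytic I' (φ ⁻¹' A) := by
  intro x
  obtain ⟨N, hN, hx, k, f, hf, C, hC⟩ := hA (φ x)
  exact ⟨φ ⁻¹' N, hN.preimage hφ.continuous, hx, k, fun i => f i ∘ φ,
    fun i => (hf i).comp hφ.contMDiffOn fun y hy => hy, C, fun y hy => hC (φ y) hy⟩

theorem IsSemianalytic.inter {A B : Set M} (hA : IsSemianalytic I A) (hB : IsSemianalytic I B) :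
    IsSemianalytic I (A ∩ B) := by
  intro x
  obtain ⟨N, hN, hx, k, f, hf, C, hC⟩ := hA x
  obtain ⟨N', hN', hx', k', f', hf', C', hC'⟩ := hB x
  refine ⟨N ∩ N', hN.inter hN', ⟨hx, hx'⟩, k + k', Fin.append f f', fun i => ?_,
    {s | (fun i => s (Fin.castAdd k' i)) ∈ C ∧ (fun i => s (Fin.natAdd k i)) ∈ C'},
    fun y hy => ?_⟩
  · refine Fin.addCases (fun i => ?_) (fun i => ?_) i
    · simpa using (hf i).mono Set.inter_subset_left
    · simpa using (hf' i).mono Set.inter_subset_right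
  · simp [hC y hy.1, hC' y hy.2]

/-- The fibre product over `M` of the two semianalytic sets `B` and `B'`, placed in `M × ℝ^(m+m')`,
projects onto the intersection. -/
theorem IsSubanalytic.inter {n : ℕ} {M : Type*} [TopologicalSpace M] [T2Space M]
    [ChartedSpace (EuclideanSpace ℝ (Fin n)) M] {A A' : Set M} (hA : IsSubanalytic n A)
    (hA' : IsSubanalytic n A') : IsSubanalytic n (A ∩ A') := by
  intro x
  obtain ⟨N, hN, hx, m, B, hB, hBc, hAB⟩ := hA x
  obtain ⟨N', hN', hx', m', B', hB', hBc', hAB'⟩ := hA' x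
  let l : (EuclideanSpace ℝ (Fin m) × EuclideanSpace ℝ (Fin m')) ≃L[ℝ]
      EuclideanSpace ℝ (Fin (m + m')) := ContinuousLinearEquiv.ofFinrankEq (by simp)
  let φ : M × EuclideanSpace ℝ (Fin (m + m')) → M × EuclideanSpace ℝ (Fin m) :=
    fun p => (p.1, (l.symm p.2).1)
  let φ' : M × EuclideanSpace ℝ (Fin (m + m')) → M × EuclideanSpace ℝ (Fin m') :=
    fun p => (p.1, (l.symm p.2).2)
  have hφ : ContMDiff ((𝓡 n).prod (𝓡 (m + m'))) ((𝓡 n).prod (𝓡 m)) ω φ :=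
    contMDiff_fst.prodMk
      ((contDiff_fst.comp l.symm.contDiff).contMDiff.comp contMDiff_snd)
  have hφ' : ContMDiff ((𝓡 n).prod (𝓡 (m + m'))) ((𝓡 n).prod (𝓡 m')) ω φ' :=
    contMDiff_fst.prodMk
      ((contDiff_snd.comp l.symm.contDiff).contMDiff.comp contMDiff_snd)
  refine ⟨N ∩ N', hN.inter hN', ⟨hx, hx'⟩, m + m', φ ⁻¹' B ∩ φ' ⁻¹' B',
    (hB.preimage hφ).inter (hB'.preimage hφ'), ?_, ?_⟩
  -- The map takes its base point from the first factor only, so it is defined on all of `closure B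
  -- ×ˢ closure B'`; its compact image may exceed the fibre product, which does no harm.
  · have hK : IsCompact ((fun q : (M × EuclideanSpace ℝ (Fin m)) × M × EuclideanSpace ℝ (Fin m') =>
        (q.1.1, l (q.1.2, q.2.2))) '' closure B ×ˢ closure B') :=
      (hBc.prod hBc').image (by fun_prop)
    refine hK.of_isClosed_subset isClosed_closure (closure_minimal ?_ hK.isClosed)
    rintro p ⟨hp, hp'⟩
    exact ⟨(φ p, φ' p), ⟨subset_closure hp, subset_closure hp'⟩, by simp [φ, φ']⟩
  · ext y
    constructor
    · rintro ⟨⟨h, h'⟩, hy, hy'⟩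
      obtain ⟨⟨z, v⟩, hb, rfl⟩ : y ∈ Prod.fst '' B := hAB ▸ ⟨h, hy⟩
      obtain ⟨⟨z', v'⟩, hb', hz⟩ : z ∈ Prod.fst '' B' := hAB' ▸ ⟨h', hy'⟩
      obtain rfl : z' = z := hz
      exact ⟨(z', l (v, v')), ⟨by simpa [φ] using hb, by simpa [φ'] using hb'⟩, rfl⟩
    · rintro ⟨p, ⟨hp, hp'⟩, rfl⟩
      have h : p.1 ∈ A ∩ N := hAB ▸ ⟨φ p, hp, rfl⟩
      have h' : p.1 ∈ A' ∩ N' := hAB' ▸ ⟨φ' p, hp', rfl⟩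
      exact ⟨⟨h.1, h'.1⟩, h.2, h'.2⟩

/-- The extra factor `A` absorbs the case of an empty family. -/
theorem IsSubanalytic.inter_biInter {n : ℕ} {M : Type*} [TopologicalSpace M] [T2Space M]
    [ChartedSpace (EuclideanSpace ℝ (Fin n)) M] {A : Set M} (hA : IsSubanalytic n A) {ι : Type*}
    {f : ι → Set M} {s : Set ι} (hs : s.Finite) (hf : ∀ i ∈ s, IsSubanalytic n (f i)) :
    IsSubanalytic n (A ∩ ⋂ i ∈ s, f i) := by
  induction s, hs using Set.Finite.induction_on with
  | empty => simpa using hA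
  | @insert i s _ _ ih =>
    rw [Set.biInter_insert, ← Set.inter_assoc, Set.inter_right_comm]
    exact (ih fun j hj => hf j (Set.mem_insert_of_mem _ hj)).inter (hf i (Set.mem_insert _ _))

end Subanalytic

/-! ### Finite suprema -/

/-- `V` is the supremum of a finite family of elements satisfying `p`. -/
def IsFiniteSup {L : Type*} [CompleteLattice L] (p : L → Prop) (V : L) : Prop :=
  ∃ 𝓑 : Set L, 𝓑.Finite ∧ (∀ P ∈ 𝓑, p P) ∧ V = sSup 𝓑

namespace IsFiniteSup

theorem of {L : Type*} [CompleteLattice L] {p : L → Prop} {V : L} (h : p V) : IsFiniteSup p V :=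
  ⟨{V}, Set.finite_singleton V, by simpa using h, sSup_singleton.symm⟩

theorem mono {L : Type*} [CompleteLattice L] {p q : L → Prop} (hpq : ∀ P, p P → q P) {V : L}
    (h : IsFiniteSup p V) : IsFiniteSup q V :=
  h.imp fun _ h => ⟨h.1, fun P hP => hpq P (h.2.1 P hP), h.2.2⟩

theorem sSup {L : Type*} [CompleteLattice L] {p : L → Prop} {𝓕 : Set L} (hF : 𝓕.Finite)
    (h : ∀ V ∈ 𝓕, IsFiniteSup p V) : IsFiniteSup p (sSup 𝓕) := by
  choose! 𝓑 h1 h2 h3 using h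
  refine ⟨⋃ V ∈ 𝓕, 𝓑 V, hF.biUnion h1, fun P hP => ?_, ?_⟩
  · obtain ⟨V, hV, hP⟩ := Set.mem_iUnion₂.1 hP
    exact h2 V hV P hP
  · simp only [sSup_iUnion]
    rw [sSup_eq_iSup]
    exact biSup_congr h3

/-- Distributivity in a frame reduces the claim to pairs of boxes. With three separate predicates,
one argument serves for objects, for members of `𝒯` and for the relation `WellInside`. -/
theorem inf {L : Type*} [Order.Frame L] {p q r : L → Prop} (hpqr : ∀ P Q, p P → q Q → r (P ⊓ Q))
    {V W : L} (hV : IsFiniteSup p V) (hW : IsFiniteSup q W) : IsFiniteSup r (V ⊓ W) := by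
  obtain ⟨𝓑, h1, h2, rfl⟩ := hV
  obtain ⟨𝓒, h3, h4, rfl⟩ := hW
  refine ⟨Set.image2 (· ⊓ ·) 𝓑 𝓒, h1.image2 _ h3, ?_, ?_⟩
  · rintro _ ⟨P, hP, Q, hQ, rfl⟩
    exact hpqr P Q (h2 P hP) (h4 Q hQ)
  · rw [sSup_inf_sSup, sSup_image2, biSup_prod]

end IsFiniteSup

/-! ### Relatively compact inclusions in `X_sa × S` -/

/-- Local compactness puts a coordinate ball with closure in some `V ∈ 𝒱` around each point of `K`,
and finitely many suffice. This is the source of every shrinking in the `S`-direction. -/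
theorem exists_finite_saCover (n : ℕ) {M : Type*} [TopologicalSpace M] [T2Space M]
    [ChartedSpace (EuclideanSpace ℝ (Fin n)) M] [IsManifold (𝓡 n) ω M] {K : Set M}
    (hK : IsCompact K) {𝒱 : Set (Opens M)} (hKV : K ⊆ (sSup 𝒱 : Opens M)) :
    ∃ 𝓔 : Set (Opens M), 𝓔.Finite ∧ K ⊆ (sSup 𝓔 : Opens M) ∧ ∀ E ∈ 𝓔,
      IsSubanalytic n (E : Set M) ∧ IsCompact (closure (E : Set M)) ∧
        ∃ V ∈ 𝒱, closure (E : Set M) ⊆ V := by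
  have : LocallyCompactSpace M := ChartedSpace.locallyCompactSpace (EuclideanSpace ℝ (Fin n)) M
  have h : ∀ x ∈ K, ∃ E : Opens M, x ∈ E ∧ IsSubanalytic n (E : Set M) ∧
      IsCompact (closure (E : Set M)) ∧ ∃ V ∈ 𝒱, closure (E : Set M) ⊆ V := by
    intro x hx
    obtain ⟨V, hV, hxV⟩ := Opens.mem_sSup.1 (hKV hx)
    obtain ⟨C, hC, hCc, hCV⟩ := exists_mem_nhds_isClosed_subset (V.isOpen.mem_nhds hxV)
    obtain ⟨E, hxE, hEC, hE, hEc⟩ := exists_subanalytic_nhd n x hC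
    exact ⟨E, hxE, hE, hEc, V, hV, (closure_minimal hEC hCc).trans hCV⟩
  choose! E hE h using h
  obtain ⟨t, ht, hKt⟩ := hK.elim_nhds_subcover (fun x => (E x : Set M))
    fun x hx => (E x).isOpen.mem_nhds (hE x hx)
  refine ⟨E '' t, t.finite_toSet.image E, fun x hx => ?_, ?_⟩
  · obtain ⟨y, hy, hxy⟩ := Set.mem_iUnion₂.1 (hKt hx)
    exact Opens.mem_sSup.2 ⟨E y, ⟨y, hy, rfl⟩, hxy⟩
  · rintro _ ⟨y, hy, rfl⟩
    exact h y (ht y hy)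

section ProductSites

variable {n d : ℕ} {X S : Type u} [TopologicalSpace X] [TopologicalSpace S]
  [ChartedSpace (EuclideanSpace ℝ (Fin n)) X] [ChartedSpace (EuclideanSpace ℝ (Fin d)) S]

theorem openBox_inf (U U' : Opens X) (V V' : Opens S) :
    openBox U V ⊓ openBox U' V' = openBox (U ⊓ U') (V ⊓ V') :=
  Opens.ext Set.prod_inter_prod

theorem openBox_mono {U U' : Opens X} {V V' : Opens S} (hU : U ≤ U') (hV : V ≤ V') :
    openBox U V ≤ openBox U' V' :=
  Set.prod_mono hU hV

variable (n) in
/-- `P = U × V` with `U` subanalytic open and `V` open. -/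
def IsSaOpenBox (P : Opens (X × S)) : Prop :=
  ∃ (U : Opens X) (V : Opens S), IsSubanalytic n (U : Set X) ∧ P = openBox U V

variable (n) in
/-- `P = A × B` with `A` relatively compact subanalytic and `B` relatively compact in an open
subset `D` such that `A × D` is contained in `O`. -/
def IsBoxWellInside (O P : Opens (X × S)) : Prop :=
  ∃ (A : Opens X) (B D : Opens S), IsSubanalytic n (A : Set X) ∧ IsCompact (closure (A : Set X)) ∧
    IsCompact (closure (B : Set S)) ∧ closure (B : Set S) ⊆ D ∧ P = openBox A B ∧ openBox A D ≤ O

variable (n) in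
/-- `V` is a finite union of boxes that are well inside `O`. -/
def WellInside (V O : Opens (X × S)) : Prop :=
  IsFiniteSup (IsBoxWellInside n O) V

theorem IsCompact.closure_inf_left {M : Type*} [TopologicalSpace M] {U V : Opens M}
    (h : IsCompact (closure (V : Set M))) : IsCompact (closure ((U ⊓ V : Opens M) : Set M)) :=
  h.of_isClosed_subset isClosed_closure (closure_mono Set.inter_subset_right)

theorem IsBoxWellInside.le {O P : Opens (X × S)} (h : IsBoxWellInside n O P) : P ≤ O := by
  obtain ⟨A, B, D, -, -, -, hBD, rfl, hO⟩ := h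
  exact (openBox_mono le_rfl (subset_closure.trans hBD)).trans hO

namespace WellInside

variable {V V' O O' : Opens (X × S)}

theorem mono_right (h : WellInside n V O) (hO : O ≤ O') : WellInside n V O' :=
  IsFiniteSup.mono (fun _ ⟨A, B, D, h1, h2, h3, h4, h5, h6⟩ =>
    ⟨A, B, D, h1, h2, h3, h4, h5, h6.trans hO⟩) h

theorem le (h : WellInside n V O) : V ≤ O := by
  obtain ⟨𝓑, -, h, rfl⟩ := h
  exact sSup_le fun P hP => (h P hP).le

theorem isFiniteSup (h : WellInside n V O) : IsFiniteSup (IsSaOpenBox n) V :=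
  IsFiniteSup.mono (fun _ ⟨A, B, _, h1, _, _, _, h5, _⟩ => ⟨A, B, h1, h5⟩) h

variable [T2Space X]

theorem inf (h : WellInside n V O) (h' : WellInside n V' O') :
    WellInside n (V ⊓ V') (O ⊓ O') := by
  refine IsFiniteSup.inf ?_ h h'
  rintro _ _ ⟨A, B, D, hA, hAc, hBc, hBD, rfl, hO⟩ ⟨A', B', D', hA', hAc', hBc', hBD', rfl, hO'⟩
  exact ⟨A ⊓ A', B ⊓ B', D ⊓ D', hA.inter hA', hAc'.closure_inf_left, hBc'.closure_inf_left,
    Set.subset_inter ((closure_mono Set.inter_subset_left).trans hBD)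
      ((closure_mono Set.inter_subset_right).trans hBD'), openBox_inf _ _ _ _,
    le_inf ((openBox_mono inf_le_left inf_le_left).trans hO)
      ((openBox_mono inf_le_right inf_le_right).trans hO')⟩

/-- Cutting a box `A' × B'` down by an object leaves its outer open set `D'` usable. -/
theorem mono_left (h : WellInside n V O) (hV' : IsFiniteSup (IsSaOpenBox n) V') (hV : V' ≤ V) :
    WellInside n V' O := by
  rw [← inf_eq_left.2 hV]
  refine IsFiniteSup.inf ?_ hV' h
  rintro _ _ ⟨A, B, hA, rfl⟩ ⟨A', B', D', hA', hAc', hBc', hBD', rfl, hO'⟩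
  exact ⟨A ⊓ A', B ⊓ B', D', hA.inter hA', hAc'.closure_inf_left, hBc'.closure_inf_left,
    (closure_mono Set.inter_subset_right).trans hBD', openBox_inf _ _ _ _,
    (openBox_mono inf_le_right le_rfl).trans hO'⟩

omit [T2Space X] in
/-- Interpolation by a finite union of products of relatively compact subanalytic sets. -/
theorem exists_between [T2Space S] [IsManifold (𝓡 d) ω S] (h : WellInside n V O) :
    ∃ P, IsFiniteUnionOfSaBoxes n d P ∧ WellInside n V P ∧ WellInside n P O := by
  have key : ∀ Q, IsBoxWellInside n O Q →
      ∃ P, IsFiniteUnionOfSaBoxes n d P ∧ IsBoxWellInside n P Q ∧ WellInside n P O := by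
    rintro _ ⟨A, B, D, hA, hAc, hBc, hBD, rfl, hO⟩
    -- The sets of `𝓔` are interpolated between the closure of `B` and `D`, with `A` kept fixed:
    -- their union is the outer set for `B`, and `D` is the outer set for each of them.
    obtain ⟨𝓔, hfin, hcov, h⟩ := exists_finite_saCover d hBc (𝒱 := {D}) (by simpa using hBD)
    refine ⟨sSup (openBox A '' 𝓔), ⟨_, hfin.image _, ?_, rfl⟩,
      ⟨A, B, sSup 𝓔, hA, hAc, hBc, hcov, rfl, ?_⟩, _, hfin.image _, ?_, rfl⟩
    · rintro _ ⟨E, hE, rfl⟩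
      exact ⟨A, E, hA, hAc, (h E hE).1, (h E hE).2.1, rfl⟩
    · rintro ⟨x, s⟩ ⟨hx, hs⟩
      obtain ⟨E, hE, hs⟩ := Opens.mem_sSup.1 hs
      exact Opens.mem_sSup.2 ⟨_, ⟨E, hE, rfl⟩, hx, hs⟩
    · rintro _ ⟨E, hE, rfl⟩
      obtain ⟨-, hEc, _, rfl, hED⟩ := h E hE
      exact ⟨A, E, _, hA, hAc, hEc, hED, rfl, hO⟩
  obtain ⟨𝓑, hfin, h, rfl⟩ := h
  choose! P h1 h2 h3 using fun Q hQ => key Q (h Q hQ)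
  refine ⟨sSup (P '' 𝓑), IsFiniteSup.sSup (hfin.image P) ?_, ⟨𝓑, hfin, fun Q hQ => ?_, rfl⟩,
    IsFiniteSup.sSup (hfin.image P) ?_⟩
  · rintro _ ⟨Q, hQ, rfl⟩
    exact h1 Q hQ
  · obtain ⟨A, B, D, hA, hAc, hBc, hBD, rfl, hO⟩ := h2 Q hQ
    exact ⟨A, B, D, hA, hAc, hBc, hBD, rfl, hO.trans (le_sSup ⟨_, hQ, rfl⟩)⟩
  · rintro _ ⟨Q, hQ, rfl⟩
    exact h3 Q hQ

end WellInside

variable [T2Space X]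

theorem IsFiniteSup.isSaOpenBox_inf {V V' : Opens (X × S)}
    (h : IsFiniteSup (IsSaOpenBox n) V) (h' : IsFiniteSup (IsSaOpenBox n) V') :
    IsFiniteSup (IsSaOpenBox n) (V ⊓ V') := by
  refine IsFiniteSup.inf ?_ h h'
  rintro _ _ ⟨A, B, hA, rfl⟩ ⟨A', B', hA', rfl⟩
  exact ⟨A ⊓ A', B ⊓ B', hA.inter hA', openBox_inf _ _ _ _⟩

theorem IsFiniteUnionOfSaBoxes.inf [T2Space S] {V V' : Opens (X × S)}
    (h : IsFiniteUnionOfSaBoxes n d V) (h' : IsFiniteUnionOfSaBoxes n d V') :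
    IsFiniteUnionOfSaBoxes n d (V ⊓ V') := by
  refine IsFiniteSup.inf ?_ h h'
  rintro _ _ ⟨A, B, hA, hAc, hB, hBc, rfl⟩ ⟨A', B', hA', hAc', hB', hBc', rfl⟩
  exact ⟨A ⊓ A', B ⊓ B', hA.inter hA', hAc'.closure_inf_left, hB.inter hB',
    hBc'.closure_inf_left, openBox_inf _ _ _ _⟩

omit [T2Space X] in
theorem IsFiniteUnionOfSaBoxes.isFiniteSup {V : Opens (X × S)}
    (h : IsFiniteUnionOfSaBoxes n d V) : IsFiniteSup (IsSaOpenBox n) V :=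
  IsFiniteSup.mono (fun _ ⟨A, B, hA, _, _, _, h⟩ => ⟨A, B, hA, h⟩) h

/-! ### The topology of `X_sa × S` -/

/-- The intersection of two objects of `op(X_sa × S)`. -/
def OpSa.inter (V W : OpSa n X S) : OpSa n X S :=
  ⟨V.1 ⊓ W.1, IsFiniteSup.isSaOpenBox_inf V.2 W.2⟩

theorem OpSa.inter_le_left (V W : OpSa n X S) : V.inter W ≤ V :=
  inf_le_left (a := V.1)

theorem OpSa.inter_le_right (V W : OpSa n X S) : V.inter W ≤ W :=
  inf_le_right (a := V.1)

variable (n X S) in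
/-- The topology on `op(X_sa × S)` whose covering sieves of `U` are those that contain, for every
`V` well inside `U`, finitely many objects in which the members of a covering of `V` are well
inside. -/
def wellInsideTopology : GrothendieckTopology (OpSa n X S) where
  sieves U := {R | ∀ V, WellInside n V U.1 → ∃ 𝓕 : Set (Opens (X × S)), 𝓕.Finite ∧ V ≤ sSup 𝓕 ∧
    ∀ V' ∈ 𝓕, ∃ (W : OpSa n X S) (f : W ⟶ U), R f ∧ WellInside n V' W.1}
  top_mem' U V hV := ⟨{V}, Set.finite_singleton V, by simp, by
    rintro _ rfl
    exact ⟨U, 𝟙 U, trivial, hV⟩⟩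
  pullback_stable' U U' R f hR V hV := by
    obtain ⟨𝓕, hfin, hcov, h⟩ := hR V (hV.mono_right (leOfHom f))
    -- Cutting each piece by `V`, which is well inside `U'`, keeps it well inside `W ∩ U'`.
    refine ⟨(· ⊓ V) '' 𝓕, hfin.image _, ?_, ?_⟩
    · rw [sSup_image, ← sSup_inf_eq]
      exact le_inf hcov le_rfl
    · rintro _ ⟨V', hV', rfl⟩
      obtain ⟨W, g, hg, hW⟩ := h V' hV'
      refine ⟨OpSa.inter W U', homOfLE (OpSa.inter_le_right W U'), ?_, hW.inf hV⟩
      exact R.downward_closed hg (homOfLE (OpSa.inter_le_left W U'))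
  transitive' U R hR R' h V hV := by
    obtain ⟨𝓕, hfin, hcov, hF⟩ := hR V hV
    have key : ∀ V' ∈ 𝓕, ∃ 𝓖 : Set (Opens (X × S)), 𝓖.Finite ∧ V' ≤ sSup 𝓖 ∧
        ∀ V'' ∈ 𝓖, ∃ (W : OpSa n X S) (f : W ⟶ U), R' f ∧ WellInside n V'' W.1 := by
      intro V' hV'
      obtain ⟨W, f, hf, hW⟩ := hF V' hV'
      obtain ⟨𝓖, h1, h2, h3⟩ := h hf V' hW
      refine ⟨𝓖, h1, h2, fun V'' hV'' => ?_⟩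
      obtain ⟨W', g, hg, hW'⟩ := h3 V'' hV''
      exact ⟨W', g ≫ f, hg, hW'⟩
    choose! 𝓖 h1 h2 h3 using key
    refine ⟨⋃ V' ∈ 𝓕, 𝓖 V', hfin.biUnion h1, hcov.trans (sSup_le fun V' hV' => ?_), ?_⟩
    · exact (h2 V' hV').trans (sSup_le_sSup (Set.subset_biUnion_of_mem hV'))
    · intro V'' hV''
      obtain ⟨V', hV', hV''⟩ := Set.mem_iUnion₂.1 hV''
      exact h3 V' hV' V'' hV''

variable [T2Space S] [IsManifold (𝓡 d) ω S]

variable (n d X S) in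
include d in
-- This extracts finiteness from an arbitrary covering sieve of the generated topology: the
-- condition defining `wellInsideTopology` need only be checked on generators. For a box `A × B`
-- with outer set `D`, compactness of the closure of `A` selects finitely many `U' ∈ 𝒰`, and
-- compactness of the closure of `B` gives finitely many `E` with closures in members of `𝒱`.
theorem saTopology_le_wellInsideTopology : saTopology n X S ≤ wellInsideTopology n X S := by
  refine Precoverage.toGrothendieck_le_iff_le_toPrecoverage.2 fun U R hR V hV => ?_
  have key : ∀ Q, IsBoxWellInside n U.1 Q → ∃ 𝓕 : Set (Opens (X × S)), 𝓕.Finite ∧ Q ≤ sSup 𝓕 ∧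
      ∀ V' ∈ 𝓕, ∃ (W : OpSa n X S) (f : W ⟶ U), Sieve.generate R f ∧ WellInside n V' W.1 := by
    rintro _ ⟨A, B, D, hA, hAc, hBc, hBD, rfl, hO⟩
    obtain ⟨𝒰, 𝒱, ⟨hU, hUc⟩, rfl, hT⟩ := hR A D hA hO
    obtain ⟨𝒰₀, h0, hfin, hcov⟩ := hUc _ hAc
    obtain ⟨𝓔, hEfin, hEcov, hE⟩ := exists_finite_saCover d hBc hBD
    refine ⟨Set.image2 openBox 𝒰₀ 𝓔, hfin.image2 _ hEfin, ?_, ?_⟩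
    · rintro ⟨x, s⟩ ⟨hx, hs⟩
      obtain ⟨U', hU', hx⟩ := Opens.mem_sSup.1 (hcov.symm ▸ ⟨subset_closure hx, hx⟩ :
        x ∈ closure (A : Set X) ∩ (sSup 𝒰₀ : Opens X)).2
      obtain ⟨E, hE, hs⟩ := Opens.mem_sSup.1 (hEcov (subset_closure hs))
      exact Opens.mem_sSup.2 ⟨_, ⟨U', hU', E, hE, rfl⟩, hx, hs⟩
    · rintro _ ⟨U', hU', E, hE', rfl⟩
      obtain ⟨-, hEc, V', hV', hEV⟩ := hE E hE'
      obtain ⟨W, ⟨f, hf⟩, hW⟩ := hT U' (h0 hU') V' hV'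
      refine ⟨W, f, Sieve.le_generate R _ _ hf, IsFiniteSup.of ⟨U', E, V', (hU U' (h0 hU')).1,
        hAc.of_isClosed_subset isClosed_closure (closure_mono (hU U' (h0 hU')).2), hEc, hEV,
        rfl, hW⟩⟩
  obtain ⟨𝓑, hfin, h, rfl⟩ := hV
  choose! 𝓕 h1 h2 h3 using fun Q hQ => key Q (h Q hQ)
  refine ⟨⋃ Q ∈ 𝓑, 𝓕 Q, hfin.biUnion h1, sSup_le fun Q hQ => ?_, ?_⟩
  · exact (h2 Q hQ).trans (sSup_le_sSup (Set.subset_biUnion_of_mem hQ))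
  · intro V' hV'
    obtain ⟨Q, hQ, hV'⟩ := Set.mem_iUnion₂.1 hV'
    exact h3 Q hQ V' hV'

omit [T2Space X] [T2Space S] [IsManifold (𝓡 d) ω S] in
theorem mem_saTopology_of_saCoverings {U : OpSa n X S} {R : Sieve U}
    (h : {W | ∃ f : W ⟶ U, R f} ∈ saCoverings n X S U) : R ∈ saTopology n X S U := by
  rw [← Sieve.generate_sieve R]
  exact Precoverage.generate_mem_toGrothendieck (J := { coverings := _ }) h

omit [T2Space S] [IsManifold (𝓡 d) ω S] in
-- A finite set-theoretic cover must be refined by a product grid. Decompose the members of `T` into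
-- finitely many boxes; let `A x` be the intersection of `U'` with the `X`-sides containing `x`, and
-- define `B s` likewise. If a box contains `(x, s)`, it contains `A x × B s`.
theorem generate_mem_saTopology_of_finite {V : OpSa n X S} {T : Set (OpSa n X S)} (hT : T.Finite)
    (hTV : ∀ W ∈ T, W ≤ V) (hV : ∀ p ∈ V.1, ∃ W ∈ T, p ∈ W.1) :
    Sieve.generate (X := V) (fun W _ => W ∈ T) ∈ saTopology n X S V := by
  refine mem_saTopology_of_saCoverings fun U' V' hU' hle => ?_
  have hex : ∀ W : OpSa n X S, ∃ 𝓑 : Set (Opens X × Opens S), 𝓑.Finite ∧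
      (∀ b ∈ 𝓑, IsSubanalytic n (b.1 : Set X) ∧ openBox b.1 b.2 ≤ W.1) ∧
      ∀ p ∈ W.1, ∃ b ∈ 𝓑, p ∈ openBox b.1 b.2 := by
    intro W
    obtain ⟨𝓑, hfin, h, hW⟩ := W.2
    choose! A B hA hAB using h
    rw [hW]
    refine ⟨(fun P => (A P, B P)) '' 𝓑, hfin.image _, ?_, fun p hp => ?_⟩
    · rintro _ ⟨P, hP, rfl⟩
      exact ⟨hA P hP, (hAB P hP).ge.trans (le_sSup hP)⟩
    · obtain ⟨P, hP, hp⟩ := Opens.mem_sSup.1 hp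
      exact ⟨_, ⟨P, hP, rfl⟩, hAB P hP ▸ hp⟩
  choose 𝓑 hfin hB hcov using hex
  set 𝓛 := ⋃ W ∈ T, 𝓑 W with h𝓛
  have hLfin : 𝓛.Finite := hT.biUnion fun W _ => hfin W
  have hsub : ∀ x, {b ∈ 𝓛 | x ∈ b.1} ⊆ 𝓛 := fun x => Set.sep_subset _ _
  have hsub' : ∀ s, {b ∈ 𝓛 | s ∈ b.2} ⊆ 𝓛 := fun s => Set.sep_subset _ _
  let A : X → Opens X := fun x => U' ⊓ ⟨⋂ b ∈ {b ∈ 𝓛 | x ∈ b.1}, (b.1 : Set X),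
    (hLfin.subset (hsub x)).isOpen_biInter fun b _ => b.1.isOpen⟩
  let B : S → Opens S := fun s => V' ⊓ ⟨⋂ b ∈ {b ∈ 𝓛 | s ∈ b.2}, (b.2 : Set S),
    (hLfin.subset (hsub' s)).isOpen_biInter fun b _ => b.2.isOpen⟩
  have hA : ∀ x ∈ U', x ∈ A x := fun x hx => ⟨hx, Set.mem_iInter₂.2 fun b hb => hb.2⟩
  have hB' : ∀ s ∈ V', s ∈ B s := fun s hs => ⟨hs, Set.mem_iInter₂.2 fun b hb => hb.2⟩
  -- The set `A x` depends on `x` only through a subset of the finite set `𝓛`.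
  have hAfin : (A '' (U' : Set X)).Finite := by
    refine Set.Finite.of_finite_image (f := ((↑) : Opens X → Set X)) ?_ SetLike.coe_injective.injOn
    refine (hLfin.powerset.image
      fun 𝓜 => (U' : Set X) ∩ ⋂ b ∈ 𝓜, (b.1 : Set X)).subset ?_
    rintro _ ⟨_, ⟨x, -, rfl⟩, rfl⟩
    exact ⟨_, hsub x, rfl⟩
  refine ⟨A '' U', B '' V', ⟨?_, fun K _ => ⟨_, subset_rfl, hAfin, ?_⟩⟩, ?_, ?_⟩
  · rintro _ ⟨x, -, rfl⟩
    refine ⟨hU'.inter_biInter (hLfin.subset (hsub x)) fun b hb => ?_, inf_le_left⟩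
    obtain ⟨W, -, hb⟩ := Set.mem_iUnion₂.1 hb.1
    exact (hB W b hb).1
  · congr 2
    refine le_antisymm (sSup_le ?_) fun x hx => Opens.mem_sSup.2 ⟨_, ⟨x, hx, rfl⟩, hA x hx⟩
    rintro _ ⟨x, -, rfl⟩
    exact inf_le_left
  · refine le_antisymm (sSup_le ?_) fun s hs => Opens.mem_sSup.2 ⟨_, ⟨s, hs, rfl⟩, hB' s hs⟩
    rintro _ ⟨s, -, rfl⟩
    exact inf_le_left
  · rintro _ ⟨x, hx, rfl⟩ _ ⟨s, hs, rfl⟩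
    obtain ⟨W, hW, hp⟩ := hV (x, s) (hle ⟨hx, hs⟩)
    obtain ⟨b, hb, hxb, hsb⟩ := hcov W (x, s) hp
    have hbL : b ∈ 𝓛 := Set.mem_biUnion hW hb
    refine ⟨W, ⟨homOfLE (hTV W hW), Sieve.le_generate _ _ _ hW⟩, le_trans ?_ (hB W b hb).2⟩
    exact openBox_mono (fun y hy => Set.mem_iInter₂.1 hy.2 b ⟨hbL, hxb⟩)
      (fun y hy => Set.mem_iInter₂.1 hy.2 b ⟨hbL, hsb⟩)

/-! ### Weak quasi-compactness in topological terms -/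

variable [IsManifold (𝓡 n) ω X]

/-- Every box `U' × V'` in `U` is covered by products of relatively compact subanalytic `A ⊆ U'` and
`B` with closure in `V'`, and these products are members of `𝒯` well inside `U`. -/
theorem mem_saTopology_of_wellInside {U : OpSa n X S} {R : Sieve U}
    (hR : ∀ (W : OpSa n X S) (h : W ≤ U), IsFiniteUnionOfSaBoxes n d W.1 → WellInside n W.1 U.1 →
      R (homOfLE h)) : R ∈ saTopology n X S U := by
  refine mem_saTopology_of_saCoverings fun U' V' hU' hle => ?_
  refine ⟨{A | IsSubanalytic n (A : Set X) ∧ IsCompact (closure (A : Set X)) ∧ A ≤ U'},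
    {B | IsSubanalytic d (B : Set S) ∧ IsCompact (closure (B : Set S)) ∧
      closure (B : Set S) ⊆ V'}, ⟨fun A hA => ⟨hA.1, hA.2.2⟩, fun K hK => ?_⟩, ?_, ?_⟩
  -- Finitely many coordinate balls cover `K`; their traces on `U'` need no control of closures
  -- inside `U'`.
  · obtain ⟨𝓔, hfin, hcov, hE⟩ := exists_finite_saCover n hK (𝒱 := {⊤}) (by simp)
    refine ⟨(U' ⊓ ·) '' 𝓔, ?_, hfin.image _, ?_⟩
    · rintro _ ⟨E, hE', rfl⟩
      exact ⟨hU'.inter (hE E hE').1, (hE E hE').2.1.closure_inf_left, inf_le_left⟩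
    · rw [sSup_image, ← inf_sSup_eq, Opens.coe_inf, Set.inter_left_comm,
        Set.inter_eq_left.2 hcov, Set.inter_comm]
  · refine le_antisymm (sSup_le fun B hB => subset_closure.trans hB.2.2) fun s hs => ?_
    obtain ⟨𝓔, -, hcov, hE⟩ := exists_finite_saCover d (isCompact_singleton (x := s)) (𝒱 := {V'})
      (by simpa using hs)
    obtain ⟨E, hE', hsE⟩ := Opens.mem_sSup.1 (hcov rfl)
    obtain ⟨h1, h2, _, rfl, h3⟩ := hE E hE'
    exact Opens.mem_sSup.2 ⟨E, ⟨h1, h2, h3⟩, hsE⟩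
  · rintro A ⟨hA, hAc, hAU⟩ B ⟨hB, hBc, hBV⟩
    have h : WellInside n (openBox A B) U.1 :=
      IsFiniteSup.of ⟨A, B, V', hA, hAc, hBc, hBV, rfl, (openBox_mono hAU le_rfl).trans hle⟩
    exact ⟨⟨openBox A B, h.isFiniteSup⟩, ⟨homOfLE h.le, hR _ h.le
      (IsFiniteSup.of ⟨A, B, hA, hAc, hB, hBc, rfl⟩) h⟩, le_rfl⟩

include d in
-- Covering sieves cover pointwise: a small box around `p` is well inside `U`, so finitely many
-- pieces lying in members of the sieve cover it.
theorem exists_mem_of_mem_saTopology {U : OpSa n X S} {R : Sieve U} (hR : R ∈ saTopology n X S U)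
    {p : X × S} (hp : p ∈ U.1) : ∃ (W : OpSa n X S) (f : W ⟶ U), R f ∧ p ∈ W.1 := by
  obtain ⟨P, hP, hp⟩ := Opens.mem_sSup.1 (U.2.choose_spec.2.2 ▸ hp)
  obtain ⟨A, B, hA, rfl⟩ := U.2.choose_spec.2.1 P hP
  obtain ⟨A', hpA, hAA, hA', hAc⟩ := exists_subanalytic_nhd n p.1 (A.isOpen.mem_nhds hp.1)
  obtain ⟨𝓔, -, hcov, hE⟩ := exists_finite_saCover d (isCompact_singleton (x := p.2)) (𝒱 := {B})
      (by simpa using hp.2)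
  obtain ⟨B', hB', hpB⟩ := Opens.mem_sSup.1 (hcov rfl)
  obtain ⟨-, hBc, _, rfl, hBB⟩ := hE B' hB'
  have h : WellInside n (openBox A' B') U.1 := IsFiniteSup.of ⟨A', B', _, hA', hAc, hBc, hBB, rfl,
    (openBox_mono hAA le_rfl).trans ((le_sSup hP).trans U.2.choose_spec.2.2.ge)⟩
  obtain ⟨𝓕, -, hle, hF⟩ := saTopology_le_wellInsideTopology n d X S U hR _ h
  obtain ⟨V, hV, hpV⟩ := Opens.mem_sSup.1 (hle ⟨hpA, hpB⟩)
  obtain ⟨W, f, hf, hW⟩ := hF V hV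
  exact ⟨W, f, hf, hW.le hpV⟩

include d in
/-- The topological description of weakly quasi-compact inclusions. -/
theorem isWeaklyQuasiCompactIn_iff {V U : OpSa n X S} :
    IsWeaklyQuasiCompactIn (saTopology n X S) V U ↔ WellInside n V.1 U.1 := by
  constructor
  · rintro ⟨hVU, h⟩
    -- Weak quasi-compactness is tested on the covering sieve of all objects well inside `U`: it
    -- presents `V` as a finite union of such objects.
    let R : Sieve U :=
      { arrows := fun W _ => WellInside n W.1 U.1
        downward_closed := fun {_ W _} h g => WellInside.mono_left h W.2 (leOfHom g) }
    obtain ⟨T, hT, hTR, hTV⟩ := h R (mem_saTopology_of_wellInside (d := d) fun W h _ h' => h')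
    have hV : V.1 = sSup ((fun W : OpSa n X S => W.1) '' T) := by
      refine le_antisymm (fun p hp => ?_) (sSup_le ?_)
      · obtain ⟨W, f, ⟨W', g, -, hW', -⟩, hpW⟩ := exists_mem_of_mem_saTopology (d := d) hTV hp
        exact Opens.mem_sSup.2 ⟨_, ⟨W', hW', rfl⟩, leOfHom g hpW⟩
      · rintro _ ⟨W, hW, rfl⟩
        exact (hTR W hW).choose
    rw [hV]
    refine IsFiniteSup.sSup (hT.image _) ?_
    rintro _ ⟨W, hW, rfl⟩
    exact (hTR W hW).choose_spec
  · refine fun h => ⟨h.le, fun R hR => ?_⟩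
    obtain ⟨𝓕, hfin, hle, hF⟩ := saTopology_le_wellInsideTopology n d X S U hR _ h
    choose! W f hf hW using hF
    -- The finite refinement consists of the traces on `V` of the pieces `V'`. Indexing by the
    -- subtype supplies the proof that each `V'` is an object.
    refine ⟨(fun V' : 𝓕 => OpSa.inter ⟨V'.1, (hW V'.1 V'.2).isFiniteSup⟩ V) '' Set.univ,
      (@Set.finite_univ _ hfin.to_subtype).image _, ?_, ?_⟩
    · rintro _ ⟨V', -, rfl⟩
      refine ⟨OpSa.inter_le_right _ V, R.downward_closed (hf V'.1 V'.2)
        (homOfLE (inf_le_left.trans (hW V'.1 V'.2).le))⟩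
    · refine generate_mem_saTopology_of_finite
        ((@Set.finite_univ _ hfin.to_subtype).image _) ?_ fun p hp => ?_
      · rintro _ ⟨V', -, rfl⟩
        exact OpSa.inter_le_right _ V
      · obtain ⟨V', hV', hpV⟩ := Opens.mem_sSup.1 (hle hp)
        exact ⟨_, ⟨⟨V', hV'⟩, trivial, rfl⟩, hpV, hp⟩

end ProductSites

/-! ### Presheaves of modules on a preorder -/

/-- The restriction maps of a presheaf of modules on a preorder. -/
def presheafRes {C : Type*} [Preorder C] (F : Cᵒᵖ ⥤ ModuleCat.{u} ℂ) {P Q : C} (h : P ≤ Q) :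
    F.obj (op Q) →ₗ[ℂ] F.obj (op P) :=
  (F.map (homOfLE h).op).hom

@[simp]
theorem presheafRes_presheafRes {C : Type*} [Preorder C] (F : Cᵒᵖ ⥤ ModuleCat.{u} ℂ) {P Q R : C}
    (h : P ≤ Q) (h' : Q ≤ R) (x : F.obj (op R)) :
    presheafRes F h (presheafRes F h' x) = presheafRes F (h.trans h') x := by
  simp only [presheafRes, ← homOfLE_comp h h', op_comp, F.map_comp, ModuleCat.hom_comp,
    LinearMap.comp_apply]

@[simp]
theorem presheafRes_self {C : Type*} [Preorder C] (F : Cᵒᵖ ⥤ ModuleCat.{u} ℂ) {P : C} (h : P ≤ P)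
    (x : F.obj (op P)) : presheafRes F h x = x := by
  simp [presheafRes]

theorem app_presheafRes {C : Type*} [Preorder C] {F G : Cᵒᵖ ⥤ ModuleCat.{u} ℂ} (φ : F ⟶ G)
    {P Q : C} (h : P ≤ Q) (x : F.obj (op Q)) :
    (φ.app (op P)).hom (presheafRes F h x) = presheafRes G h ((φ.app (op Q)).hom x) :=
  NatTrans.naturality_apply φ (homOfLE h).op x

section ProductSites

variable {n d : ℕ} {X S : Type u} [TopologicalSpace X] [TopologicalSpace S]
  [ChartedSpace (EuclideanSpace ℝ (Fin n)) X] [ChartedSpace (EuclideanSpace ℝ (Fin d)) S]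

/-! ### Sections of `F` over the members of `𝒯` that are well inside an open set -/

/-- `P` is a member of `𝒯` that is well inside `O`. -/
def IsInterior (O : Opens (X × S)) (P : OpSaSa n d X S) : Prop :=
  IsFiniteUnionOfSaBoxes n d P.1 ∧ WellInside n P.1 O

theorem IsInterior.mono {O O' : Opens (X × S)} {P : OpSaSa n d X S} (h : IsInterior O P)
    (hO : O ≤ O') : IsInterior O' P :=
  ⟨h.1, h.2.mono_right hO⟩

/-- A member of `𝒯` as an object of `op(X_sa × S_sa)`. -/
def OpSaSa.ofFinite (P : Opens (X × S)) (h : IsFiniteUnionOfSaBoxes n d P) : OpSaSa n d X S :=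
  ⟨P, h.choose, h.choose_spec.2.1,
    have := h.choose_spec.1.to_subtype
    locallyFinite_of_finite _, h.choose_spec.2.2⟩

variable (F : (OpSaSa n d X S)ᵒᵖ ⥤ ModuleCat.{u} ℂ)

/-- Compatible families of sections of `F` over the members of `𝒯` that are well inside `O`. -/
def interiorSections (O : Opens (X × S)) :
    Submodule ℂ (∀ P : {P : OpSaSa n d X S // IsInterior O P}, F.obj (op P.1)) where
  carrier := {s | ∀ (P Q : {P : OpSaSa n d X S // IsInterior O P}) (h : P.1 ≤ Q.1),
    presheafRes F h (s Q) = s P}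
  add_mem' hs ht P Q h := by simp [hs P Q h, ht P Q h]
  zero_mem' P Q h := by simp
  smul_mem' c s hs P Q h := by simp [hs P Q h]

/-- The restriction of compatible families to a smaller open set. -/
def interiorSectionsRes {O O' : Opens (X × S)} (h : O ≤ O') :
    interiorSections F O' →ₗ[ℂ] interiorSections F O :=
  (LinearMap.pi fun P : {P : OpSaSa n d X S // IsInterior O P} =>
    LinearMap.proj (⟨P.1, P.2.mono h⟩ : {P : OpSaSa n d X S // IsInterior O' P})).restrict
    fun _ hs P Q hPQ => hs ⟨P.1, P.2.mono h⟩ ⟨Q.1, Q.2.mono h⟩ hPQ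

/-- The presheaf `O ↦ lim_P Γ(P; F)`, where `P` runs through the members of `𝒯` that are well
inside `O`. -/
def interiorPresheaf : (Opens (X × S))ᵒᵖ ⥤ ModuleCat.{u} ℂ where
  obj O := ModuleCat.of ℂ (interiorSections F O.unop)
  map f := ModuleCat.ofHom (interiorSectionsRes F (leOfHom f.unop))

/-- The restriction of a section of `F` to the members of `𝒯` that are well inside its domain. -/
def toInteriorSections (W : OpSaSa n d X S) : F.obj (op W) →ₗ[ℂ] interiorSections F W.1 :=
  (LinearMap.pi fun P : {P : OpSaSa n d X S // IsInterior W.1 P} =>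
    presheafRes F P.2.2.le).codRestrict _ fun s P Q h => by simp

/-- The natural map from `F` to `interiorPresheaf F`. -/
def toInterior : F ⟶ (saSaInclusion n d X S).op ⋙ interiorPresheaf F where
  app W := ModuleCat.ofHom (toInteriorSections F W.unop)
  naturality W W' f := by
    ext s
    refine Subtype.ext (funext fun P => ?_)
    exact presheafRes_presheafRes F P.2.2.le (leOfHom f.unop) s

theorem mem_saSaTopology_of_finite {P : OpSaSa n d X S} {R : Sieve P} {T : Set (OpSaSa n d X S)}
    (hT : T.Finite) (hTR : ∀ Q ∈ T, ∃ f : Q ⟶ P, R f) (hcov : ∀ p ∈ P.1, ∃ Q ∈ T, p ∈ Q.1) :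
    R ∈ saSaTopology n d X S P := by
  rw [← Sieve.generate_sieve R]
  refine Precoverage.generate_mem_toGrothendieck (J := { coverings := _ })
    fun B _ hBP => ⟨T, hTR, hT, fun p hp => ?_⟩
  obtain ⟨Q, hQ, hp⟩ := hcov p (hBP hp)
  exact Set.mem_biUnion hQ hp

/-! ### Gluing compatible families -/

variable [T2Space X] [T2Space S]

/-- The intersection of two members of `𝒯`. -/
def OpSaSa.inter {P Q : OpSaSa n d X S} (hP : IsFiniteUnionOfSaBoxes n d P.1)
    (hQ : IsFiniteUnionOfSaBoxes n d Q.1) : OpSaSa n d X S :=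
  OpSaSa.ofFinite (P.1 ⊓ Q.1) (hP.inf hQ)

theorem OpSaSa.inter_le_left {P Q : OpSaSa n d X S} (hP : IsFiniteUnionOfSaBoxes n d P.1)
    (hQ : IsFiniteUnionOfSaBoxes n d Q.1) : OpSaSa.inter hP hQ ≤ P :=
  inf_le_left (a := P.1)

theorem OpSaSa.inter_le_right {P Q : OpSaSa n d X S} (hP : IsFiniteUnionOfSaBoxes n d P.1)
    (hQ : IsFiniteUnionOfSaBoxes n d Q.1) : OpSaSa.inter hP hQ ≤ Q :=
  inf_le_right (a := P.1)

theorem IsInterior.inter {O O' : Opens (X × S)} {P Q : OpSaSa n d X S} (hP : IsInterior O P)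
    (hQ : IsInterior O' Q) : IsInterior (O ⊓ O') (OpSaSa.inter hP.1 hQ.1) :=
  ⟨hP.1.inf hQ.1, hP.2.inf hQ.2⟩

variable [IsManifold (𝓡 d) ω S]

/-- A covering sieve of `U` induces a covering of every member of `𝒯` that is well inside `U`. -/
theorem generate_isInterior_mem_saSaTopology {U : OpSa n X S} {R : Sieve U}
    (hR : R ∈ saTopology n X S U) {P : OpSaSa n d X S} (hP : IsInterior U.1 P) :
    Sieve.generate (X := P) (fun Q _ => ∃ (W : OpSa n X S) (f : W ⟶ U), R f ∧ IsInterior W.1 Q) ∈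
      saSaTopology n d X S P := by
  obtain ⟨𝓕, hfin, hcov, hF⟩ := saTopology_le_wellInsideTopology n d X S U hR _ hP.2
  have key : ∀ V ∈ 𝓕, ∃ Q : OpSaSa n d X S, V ⊓ P.1 ≤ Q.1 ∧ Q ≤ P ∧
      ∃ (W : OpSa n X S) (f : W ⟶ U), R f ∧ IsInterior W.1 Q := by
    intro V hV
    obtain ⟨W, f, hf, hW⟩ := hF V hV
    -- The piece `V` need not have subanalytic `S`-sides, so it is enlarged to a member of `𝒯` still
    -- well inside `W`.
    obtain ⟨Q, hQ, hVQ, hQW⟩ := hW.exists_between (d := d)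
    refine ⟨OpSaSa.inter (P := OpSaSa.ofFinite Q hQ) hQ hP.1, inf_le_inf_right _ hVQ.le,
      OpSaSa.inter_le_right (P := OpSaSa.ofFinite Q hQ) hQ hP.1, W, f, hf, hQ.inf hP.1,
      hQW.mono_left (hQ.inf hP.1).isFiniteSup inf_le_left⟩
  have : Nonempty (OpSaSa n d X S) := ⟨P⟩
  choose! Q hVQ hQP hQ using key
  refine mem_saSaTopology_of_finite (hfin.image Q) ?_ fun p hp => ?_
  · rintro _ ⟨V, hV, rfl⟩
    exact ⟨homOfLE (hQP V hV), Sieve.le_generate _ _ _ (hQ V hV)⟩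
  · obtain ⟨V, hV, hpV⟩ := Opens.mem_sSup.1 (hcov hp)
    exact ⟨_, ⟨V, hV, rfl⟩, hVQ V hV ⟨hpV, hp⟩⟩

/-- `interiorPresheaf F` restricts to a sheaf on `X_sa × S`. -/
theorem isSheaf_interiorPresheaf (F : Sheaf (saSaTopology n d X S) (ModuleCat.{u} ℂ)) :
    Presheaf.IsSheaf (saTopology n X S) ((saInclusion n X S).op ⋙ interiorPresheaf F.obj) := by
  rw [Presheaf.isSheaf_iff_isSheaf_forget _ _ (forget _), isSheaf_iff_isSheaf_of_type]
  intro U R hR x hx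
  have hFs : Presieve.IsSheaf (saSaTopology n d X S) (F.obj ⋙ forget _) := by
    rw [← isSheaf_iff_isSheaf_of_type]
    exact (Presheaf.isSheaf_iff_isSheaf_forget _ F.obj (forget _)).1 F.property
  let y : ∀ (W : OpSa n X S) (f : W ⟶ U), R f → interiorSections F.obj W.1 := fun W f hf => x f hf
  -- Both components restrict to the component at `Q ∩ Q'`, which is well inside `W ∩ W'`, where the
  -- matching condition applies.
  have hy : ∀ {W W' : OpSa n X S} (f : W ⟶ U) (hf : R f) (f' : W' ⟶ U) (hf' : R f')
      {Q Q' Z : OpSaSa n d X S} (hQ : IsInterior W.1 Q) (hQ' : IsInterior W'.1 Q')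
      (hZ : Z ≤ Q) (hZ' : Z ≤ Q'), presheafRes F.obj hZ ((y W f hf).1 ⟨Q, hQ⟩) =
        presheafRes F.obj hZ' ((y W' f' hf').1 ⟨Q', hQ'⟩) := by
    intro W W' f hf f' hf' Q Q' Z hQ hQ' hZ hZ'
    have h : Z ≤ OpSaSa.inter hQ.1 hQ'.1 := show Z.1 ≤ Q.1 ⊓ Q'.1 from le_inf hZ hZ'
    have hQQ := hQ.inter hQ'
    have e := hx (homOfLE (OpSa.inter_le_left W W')) (homOfLE (OpSa.inter_le_right W W')) hf hf' rfl
    have e' := congrFun (congrArg Subtype.val e) ⟨_, hQQ⟩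
    have e1 := (y W f hf).2 ⟨_, hQQ.mono inf_le_left⟩ ⟨Q, hQ⟩ (OpSaSa.inter_le_left hQ.1 hQ'.1)
    have e2 := (y W' f' hf').2 ⟨_, hQQ.mono inf_le_right⟩ ⟨Q', hQ'⟩
      (OpSaSa.inter_le_right hQ.1 hQ'.1)
    rw [← presheafRes_presheafRes F.obj h (OpSaSa.inter_le_left hQ.1 hQ'.1),
      ← presheafRes_presheafRes F.obj h (OpSaSa.inter_le_right hQ.1 hQ'.1), e1, e2]
    exact congrArg _ e'
  -- At each `P` the sheaf property of `F` glues the components over the `Q ≤ P` well inside some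
  -- member of `R`. The member is selected by choice; `hy` shows that the selection does not matter.
  have glue : ∀ P : {P : OpSaSa n d X S // IsInterior U.1 P}, ∃! s : F.obj.obj (op P.1),
      ∀ (Q : OpSaSa n d X S) (hQP : Q ≤ P.1) (W : OpSa n X S) (f : W ⟶ U) (hf : R f)
        (hQ : IsInterior W.1 Q), presheafRes F.obj hQP s = (y W f hf).1 ⟨Q, hQ⟩ := by
    rintro ⟨P, hP⟩
    have hsh := (Presieve.isSheafFor_iff_generate _).2
      (hFs _ (generate_isInterior_mem_saSaTopology hR hP))
    obtain ⟨s, hs, huniq⟩ := hsh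
      (fun Q _ hQ => (y hQ.choose hQ.choose_spec.choose hQ.choose_spec.choose_spec.1).1
        ⟨Q, hQ.choose_spec.choose_spec.2⟩) (fun Q Q' Z g g' _ _ _ _ _ =>
          hy _ _ _ _ _ _ (leOfHom g) (leOfHom g'))
    refine ⟨s, fun Q hQP W f hf hQ => ?_, fun t ht => huniq t fun Q g hQ =>
      ht Q (leOfHom g) _ _ _ _⟩
    have hex : ∃ (W : OpSa n X S) (f : W ⟶ U), R f ∧ IsInterior W.1 Q := ⟨W, f, hf, hQ⟩
    have h1 := hs (homOfLE hQP) hex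
    have h2 := hy hex.choose_spec.choose hex.choose_spec.choose_spec.1 f hf
      hex.choose_spec.choose_spec.2 hQ (le_refl Q) (le_refl Q)
    rw [presheafRes_self, presheafRes_self] at h2
    exact Eq.trans h1 h2
  choose s hs huniq using glue
  -- Compatibility of the glued sections follows from their uniqueness.
  have hmem : s ∈ interiorSections F.obj U.1 := fun P Q h => huniq P _
    fun Q' hQ' W f hf hQW => by simpa using hs Q Q' (hQ'.trans h) W f hf hQW
  refine ⟨(⟨s, hmem⟩ : interiorSections F.obj U.1), fun W f hf => ?_, fun t ht => ?_⟩
  · refine Subtype.ext (funext fun P => ?_)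
    have := hs ⟨P.1, P.2.mono (leOfHom f)⟩ P.1 le_rfl W f hf P.2
    rw [presheafRes_self] at this
    exact this
  · let t' : interiorSections F.obj U.1 := t
    refine Subtype.ext (funext fun P => huniq P (t'.1 P) fun Q hQP W f hf hQ => ?_)
    rw [t'.2 ⟨Q, hQ.mono (leOfHom f)⟩ P hQP]
    exact congrFun (congrArg Subtype.val (ht f hf)) ⟨Q, hQ⟩

/-- `interiorPresheaf F` as a sheaf on `X_sa × S`. -/
def interiorSheaf (F : Sheaf (saSaTopology n d X S) (ModuleCat.{u} ℂ)) :
    Sheaf (saTopology n X S) (ModuleCat.{u} ℂ) :=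
  ⟨(saInclusion n X S).op ⋙ interiorPresheaf F.obj, isSheaf_interiorPresheaf F⟩

/-! ### Comparison with the inverse image -/

/-- The natural map from the inverse image presheaf. -/
noncomputable def inverseImagePresheafToInterior
    (F : Sheaf (saSaTopology n d X S) (ModuleCat.{u} ℂ)) :
    inverseImagePresheaf F ⟶ (interiorSheaf F).obj :=
  Functor.whiskerLeft (saInclusion n X S).op
    ((((saSaInclusion n d X S).op.lanAdjunction (ModuleCat.{u} ℂ)).homEquiv F.obj
      (interiorPresheaf F.obj)).symm (toInterior F.obj))

/-- A member of `𝒯` as an object of `op(X_sa × S)`. -/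
def OpSaSa.toOpSa {P : OpSaSa n d X S} (hP : IsFiniteUnionOfSaBoxes n d P.1) : OpSa n X S :=
  ⟨P.1, hP.isFiniteSup⟩

/-- The section of the inverse image presheaf given by a section of `F` over a member of `𝒯`. -/
noncomputable def inverseImagePresheafOfSection
    (F : Sheaf (saSaTopology n d X S) (ModuleCat.{u} ℂ)) {P : OpSaSa n d X S}
    (hP : IsFiniteUnionOfSaBoxes n d P.1) :
    F.obj.obj (op P) →ₗ[ℂ] (inverseImagePresheaf F).obj (op (OpSaSa.toOpSa hP)) :=
  (((saSaInclusion n d X S).op.lanUnit.app F.obj).app (op P)).hom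

omit [T2Space X] [T2Space S] [IsManifold (𝓡 d) ω S] in
-- The inclusion of `op(X_sa × S_sa)` is fully faithful, so the unit of its Kan extension is an
-- isomorphism: the colimit over objects containing `P` is attained at `P`.
theorem inverseImagePresheafOfSection_surjective
    (F : Sheaf (saSaTopology n d X S) (ModuleCat.{u} ℂ)) {P : OpSaSa n d X S}
    (hP : IsFiniteUnionOfSaBoxes n d P.1) :
    Function.Surjective (inverseImagePresheafOfSection F hP) := by
  have : (saSaInclusion n d X S).Full := ⟨fun f => ⟨homOfLE (leOfHom f), rfl⟩⟩
  have : (saSaInclusion n d X S).Faithful := ⟨fun _ => Subsingleton.elim _ _⟩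
  exact ((ConcreteCategory.isIso_iff_bijective
    (((saSaInclusion n d X S).op.lanUnit.app F.obj).app (op P))).1 inferInstance).2

omit [T2Space X] [T2Space S] [IsManifold (𝓡 d) ω S] in
theorem inverseImagePresheafOfSection_res
    (F : Sheaf (saSaTopology n d X S) (ModuleCat.{u} ℂ)) {P Q : OpSaSa n d X S}
    (hP : IsFiniteUnionOfSaBoxes n d P.1) (hQ : IsFiniteUnionOfSaBoxes n d Q.1) (h : P ≤ Q)
    (s : F.obj.obj (op Q)) :
    inverseImagePresheafOfSection F hP (presheafRes F.obj h s) =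
      presheafRes (inverseImagePresheaf F) (P := OpSaSa.toOpSa hP) (Q := OpSaSa.toOpSa hQ) h
        (inverseImagePresheafOfSection F hQ s) :=
  app_presheafRes ((saSaInclusion n d X S).op.lanUnit.app F.obj) h s

theorem inverseImagePresheafToInterior_ofSection
    (F : Sheaf (saSaTopology n d X S) (ModuleCat.{u} ℂ)) {P : OpSaSa n d X S}
    (hP : IsFiniteUnionOfSaBoxes n d P.1) (s : F.obj.obj (op P)) :
    ((inverseImagePresheafToInterior F).app (op (OpSaSa.toOpSa hP))).hom
      (inverseImagePresheafOfSection F hP s) = toInteriorSections F.obj P s := by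
  have h := (((saSaInclusion n d X S).op.lanAdjunction (ModuleCat.{u} ℂ)).homEquiv F.obj
      (interiorPresheaf F.obj)).apply_symm_apply (toInterior F.obj)
  rw [Adjunction.homEquiv_unit, Functor.lanAdjunction_unit] at h
  exact congrArg (fun φ => (φ.app (op P)).hom s) h

variable [IsManifold (𝓡 n) ω X]

/-- Over a member `W` of `𝒯` well inside `U`, a compatible family is the image of its own component
at `W`; such `W` generate a covering sieve. -/
instance (F : Sheaf (saSaTopology n d X S) (ModuleCat.{u} ℂ)) :
    Presheaf.IsLocallySurjective (saTopology n X S) (inverseImagePresheafToInterior F) where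
  imageSieve_mem {U} s := by
    let s' : interiorSections F.obj U.1 := s
    refine mem_saTopology_of_wellInside (d := d) fun W h hW hWU => ?_
    have hP : IsInterior U.1 (OpSaSa.ofFinite W.1 hW) := ⟨hW, hWU⟩
    refine ⟨inverseImagePresheafOfSection F (P := OpSaSa.ofFinite W.1 hW) hW (s'.1 ⟨_, hP⟩), ?_⟩
    refine (inverseImagePresheafToInterior_ofSection F (P := OpSaSa.ofFinite W.1 hW) hW _).trans ?_
    exact Subtype.ext (funext fun Q => s'.2 ⟨Q.1, Q.2.mono h⟩ ⟨_, hP⟩ Q.2.2.le)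

/-- For `W` well inside `U`, insert `P ∈ 𝒯` between them. On `P` a presheaf section comes from some
`t ∈ Γ(P; F)`, and the restriction of `t` to `W` is the `W`-component of the image family, hence
determined by that image. The larger `P` is needed because `W` need not be well inside itself. -/
instance (F : Sheaf (saSaTopology n d X S) (ModuleCat.{u} ℂ)) :
    Presheaf.IsLocallyInjective (saTopology n X S) (inverseImagePresheafToInterior F) where
  equalizerSieve_mem {U} x y hxy := by
    refine mem_saTopology_of_wellInside (d := d) fun W h hW hWU => ?_
    obtain ⟨P, hP, hWP, hPU⟩ := hWU.exists_between (d := d)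
    let P' : OpSaSa n d X S := OpSaSa.ofFinite P hP
    let W' : OpSaSa n d X S := OpSaSa.ofFinite W.1 hW
    have hP' : IsFiniteUnionOfSaBoxes n d P'.1 := hP
    have hPU' : OpSaSa.toOpSa hP' ≤ U.unop := hPU.le
    have hWP' : W' ≤ P' := hWP.le
    have key : ∀ z : (inverseImagePresheaf F).obj U, ∃ t : F.obj.obj (op P'),
        inverseImagePresheafOfSection F hW (presheafRes F.obj hWP' t) =
          presheafRes (inverseImagePresheaf F) h z ∧ presheafRes F.obj hWP' t =
          (presheafRes (interiorSheaf F).obj hPU'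
            (((inverseImagePresheafToInterior F).app U).hom z) : interiorSections F.obj P).1
            ⟨W', hW, hWP⟩ := by
      intro z
      obtain ⟨t, ht⟩ := inverseImagePresheafOfSection_surjective F hP'
        (presheafRes (inverseImagePresheaf F) hPU' z)
      refine ⟨t, ?_, ?_⟩
      · refine (inverseImagePresheafOfSection_res F hW hP' hWP' t).trans ?_
        rw [ht]
        exact presheafRes_presheafRes _ _ _ _
      · have := inverseImagePresheafToInterior_ofSection F hP' t
        rw [ht, app_presheafRes] at this
        exact (congrFun (congrArg Subtype.val this) ⟨W', hW, hWP⟩).symm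
    obtain ⟨t, ht, ht'⟩ := key x
    obtain ⟨t₁, ht₁, ht₁'⟩ := key y
    have e : presheafRes F.obj hWP' t = presheafRes F.obj hWP' t₁ := by
      rw [ht', ht₁']
      exact congrArg (fun z => (presheafRes (interiorSheaf F).obj hPU' z :
        interiorSections F.obj P).1 ⟨W', hW, hWP⟩) hxy
    exact ht.symm.trans ((congrArg _ e).trans ht₁)

/-- The inverse image of `F` is the sheaf of compatible families of sections of `F` over the
members of `𝒯` that are well inside an open set. -/
theorem nonempty_inverseImage_iso (F : Sheaf (saSaTopology n d X S) (ModuleCat.{u} ℂ)) :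
    Nonempty (inverseImage F ≅ interiorSheaf F) := by
  -- A locally bijective morphism becomes an isomorphism after sheafification, and the counit is an
  -- isomorphism at the target, which is already a sheaf.
  have hW := (saTopology n X S).W_of_isLocallyBijective (inverseImagePresheafToInterior F)
  have := ((saTopology n X S).W_iff _).1 hW
  exact ⟨@asIso _ _ _ _ _ this ≪≫
    asIso ((sheafificationAdjunction (saTopology n X S) (ModuleCat.{u} ℂ)).counit.app
      (interiorSheaf F))⟩

/-! ### c-softness -/

/-- A sheaf is c-soft if every section over a neighbourhood of `V` extends to `W` after
restriction to a smaller neighbourhood. -/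
theorem isCSoft_of_forall_exists {C : Type u} [Preorder C] {J : GrothendieckTopology C}
    (G : Sheaf J (ModuleCat.{u} ℂ))
    (h : ∀ V U W : C, IsWeaklyQuasiCompactIn J V U → IsWeaklyQuasiCompactIn J V W →
      ∀ s : G.obj.obj (op U), ∃ (P : C) (hPU : P ≤ U) (hPW : P ≤ W) (t : G.obj.obj (op W)),
        IsWeaklyQuasiCompactIn J V P ∧ presheafRes G.obj hPW t = presheafRes G.obj hPU s) :
    IsCSoft G := by
  intro Y V W _ _ hVW
  have hι : ∀ {P U : C} (hP : IsWeaklyQuasiCompactIn J V P) (hU : IsWeaklyQuasiCompactIn J V U)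
      (hPU : P ≤ U) (s : G.obj.obj (op U)),
      (colimit.ι (germSystem G V) (op ⟨P, hP⟩)).hom (presheafRes G.obj hPU s) =
        (colimit.ι (germSystem G V) (op ⟨U, hU⟩)).hom s := fun {P U} hP hU hPU s =>
    congrArg (fun φ => φ.hom s) (colimit.w (germSystem G V)
      (homOfLE (show (⟨P, hP⟩ : WeaklyQuasiCompactNhd J V) ≤ ⟨U, hU⟩ from hPU)).op)
  -- Surjectivity is the vanishing of the projection to the cokernel, which can be tested on each
  -- term of the colimit.
  let q := (LinearMap.range (colimit.ι (germSystem G V) (op ⟨W, hVW⟩)).hom).mkQ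
  have hq : ModuleCat.ofHom q = 0 := by
    refine colimit.hom_ext fun U => ?_
    ext s
    obtain ⟨P, hPU, hPW, t, hP, ht⟩ := h V U.unop.1 W U.unop.2 hVW s
    refine (Submodule.Quotient.mk_eq_zero _).2 ⟨t, ?_⟩
    rw [← hι hP hVW hPW, ht]
    exact hι hP U.unop.2 hPU s
  rw [← LinearMap.range_eq_top, ← Submodule.ker_mkQ (LinearMap.range _), LinearMap.ker_eq_top]
  exact congrArg ModuleCat.Hom.hom hq

variable [SecondCountableTopology X] [SecondCountableTopology S]

/-- This is the only use of flabbiness: the component of `s` at an interpolated `P ∈ 𝒯` extends to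
`X × S`. Every `Q` well inside `P` sees only that component, so the extension and `s` give the same
family over `P`. -/
theorem IsTFlabby.exists_extension {F : Sheaf (saSaTopology n d X S) (ModuleCat.{u} ℂ)}
    (hF : IsTFlabby F) {V U W : OpSa n X S} (hU : IsWeaklyQuasiCompactIn (saTopology n X S) V U)
    (hW : IsWeaklyQuasiCompactIn (saTopology n X S) V W) (s : (interiorSheaf F).obj.obj (op U)) :
    ∃ (P : OpSa n X S) (hPU : P ≤ U) (hPW : P ≤ W) (t : (interiorSheaf F).obj.obj (op W)),
      IsWeaklyQuasiCompactIn (saTopology n X S) V P ∧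
        presheafRes (interiorSheaf F).obj hPW t = presheafRes (interiorSheaf F).obj hPU s := by
  have hV : WellInside n V.1 (U.1 ⊓ W.1) := by
    simpa using ((isWeaklyQuasiCompactIn_iff (d := d)).1 hU).inf
      ((isWeaklyQuasiCompactIn_iff (d := d)).1 hW)
  obtain ⟨P, hP, hVP, hPUW⟩ := hV.exists_between (d := d)
  let P' : OpSaSa n d X S := OpSaSa.ofFinite P hP
  have hPU : IsInterior U.1 P' := ⟨hP, hPUW.mono_right inf_le_left⟩
  let s' : interiorSections F.obj U.1 := s
  obtain ⟨f, hf⟩ := hF P' hP (s'.1 ⟨P', hPU⟩)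
  refine ⟨⟨P, hP.isFiniteSup⟩, hPUW.le.trans inf_le_left, hPUW.le.trans inf_le_right,
    (interiorSectionsRes F.obj (le_top (a := W.1)) (toInteriorSections F.obj (saSaTop n d X S) f) :
      interiorSections F.obj W.1), (isWeaklyQuasiCompactIn_iff (d := d)).2 hVP,
    Subtype.ext (funext fun Q => ?_)⟩
  have hQP : Q.1 ≤ P' := Q.2.2.le
  refine Eq.trans ?_ (s'.2 ⟨Q.1, Q.2.mono (hPUW.le.trans inf_le_left)⟩ ⟨P', hPU⟩ hQP)
  rw [← hf]
  exact (presheafRes_presheafRes F.obj hQP (le_top (a := P)) f).symm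

end ProductSites

theorem mainTheorem8 (n d : ℕ) (X S : Type u) [TopologicalSpace X] [TopologicalSpace S]
    [T2Space X] [T2Space S] [SecondCountableTopology X] [SecondCountableTopology S]
    [ChartedSpace (EuclideanSpace ℝ (Fin n)) X] [ChartedSpace (EuclideanSpace ℝ (Fin d)) S]
    [IsManifold (𝓡 n) ω X] [IsManifold (𝓡 d) ω S]
    (F : Sheaf (saSaTopology n d X S) (ModuleCat.{u} ℂ)) (hF : IsTFlabby F) :
    IsCSoft (inverseImage F) := by
  obtain ⟨e⟩ := nonempty_inverseImage_iso F
  refine isCSoft_of_forall_exists _ fun V U W hU hW s => ?_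
  obtain ⟨P, hPU, hPW, t, hP, ht⟩ := hF.exists_extension hU hW ((e.hom.hom.app (op U)).hom s)
  -- The extension is found in the model and carried back through `e`; this identity returns the
  -- original section.
  have he : ∀ (O : OpSa n X S) (z : (inverseImage F).obj.obj (op O)),
      (e.inv.hom.app (op O)).hom ((e.hom.hom.app (op O)).hom z) = z := fun O z =>
    congrArg (fun φ => (φ.hom.app (op O)).hom z) e.hom_inv_id
  refine ⟨P, hPU, hPW, (e.inv.hom.app (op W)).hom t, hP, ?_⟩
  rw [← app_presheafRes, ht, app_presheafRes, he]
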